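/- For $k\ge 0$ and $m\in\mathbb N$, an $m$-cover of $[k]=\{1,\dots,k\}$ is a finite multiset of nonempty subsets of $[k]$ such that every $j\in[k]$ lies in exactly $m$ of them (counted with multiplicity). Let $v_{k;m}$ be the number of $m$-covers of $[k]$ (so $v_{0;m}=1$), and let $V_m(x)=\sum_{k\ge 0}\frac{v_{k;m}}{k!}x^k$ be their exponential generating function. Let $Z_1,Z_{1/2},\dots,Z_{1/m}$ be independent random variables, $Z_{1/j}$ having the Poisson distribution with parameter $1/j$, and put $$\mathcal E_m=\sum_{\substack{(l_1,\dots,l_m):\ \sum_{j=1}^m j l_j=m\\ 0\le l_j\le Z_{1/j}}}\ \prod_{j=1}^m\binom{Z_{1/j}}{l_j}.$$ For $u=(u_1,\dots,u_m)\in\mathbb Z_{\ge0}^m$ let $\gamma_m(u)=[z^m]\prod_{j=1}^m(1+z^j)^{u_j}$ (the coefficient of $z^m$). Then $$V_m(x)=E\,e^{x\mathcal E_m}=e^{-\sum_{j=1}^m\frac1j}\sum_{u_1,\dots,u_m\ge0}\Big(\prod_{j=1}^m\frac{j^{-u_j}}{u_j!}\Big)e^{x\gamma_m(u)}.$$ These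 identities hold between formal power series in $x$, where $e^{ax}=\sum_k a^kx^k/k!$, and the expectation and the sum over $u$ are taken coefficient by coefficient (all of them converge). Moreover, the second equality holds for every real $x$ and the first for every real $x\ge0$, with values in $[0,\infty]$; and at every real $x$ at which the series $V_m(x)$ converges, all three expressions are finite and equal. In particular (Comtet; Bender), as formal power series, $$V_2(x)=e^{-\frac32}e^{\frac12e^x}\sum_{r=0}^\infty\frac{e^{\binom r2x}}{r!},\qquad V_3(x)=e^{-\frac{11}6}e^{\frac13e^x}\sum_{r=0}^\infty\frac{e^{\binom r3x+\frac12e^{rx}}}{r!};$$ the formula for general $m$ is that of Devitt and Jackson. -/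

import Mathlib

open MeasureTheory ProbabilityTheory
open scoped PowerSeries PowerSeries.WithPiTopology Nat

namespace MCover

/-- An `m`-cover of `[k]`: a finite collection (unlabelled, repetitions allowed, that is, a
multiset) of nonempty subsets of `[k]` such that every `j ∈ [k]` belongs to exactly `m` of its
members. Its order is the number of its members. -/
def IsCover (k m : ℕ) (c : Multiset (Finset (Fin k))) : Prop :=
  (∀ s ∈ c, s.Nonempty) ∧ ∀ j : Fin k, c.countP (fun s => j ∈ s) = m

/-- The number of sets in an `m`-cover being at most `k * m`, there are finitely many of them. -/
theorem finite_setOf_isCover (k m : ℕ) : {c | IsCover k m c}.Finite := by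
  have key : ∀ c, IsCover k m c → ∀ s, c.count s ≤ m := by
    intro c hc s
    by_cases hs : s ∈ c
    · obtain ⟨j, hj⟩ := hc.1 s hs
      rw [← hc.2 j, Multiset.count]
      rw [Multiset.countP_eq_card_filter, Multiset.countP_eq_card_filter]
      exact Multiset.card_le_card
        (Multiset.monotone_filter_right c (fun t ht => by rw [← ht]; exact hj))
    · rw [Multiset.count_eq_zero_of_notMem hs]
      exact Nat.zero_le m
  apply Set.Finite.of_finite_image
    (f := fun (c : Multiset (Finset (Fin k))) (s : Finset (Fin k)) => c.count s)
  · refine (Set.Finite.pi' (fun _ : Finset (Fin k) => Set.finite_Iic m)).subset ?_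
    rintro _ ⟨c, hc, rfl⟩ s
    exact key c hc s
  · intro c _ d _ h
    exact Multiset.ext.2 (fun s => congrFun h s)

/-- `v_{k;m}`: the total number of `m`-covers of `[k]`, of whatever order. -/
noncomputable def coverNumber (k m : ℕ) : ℕ := {c | IsCover k m c}.ncard

/-- The exponential generating function `V_m = ∑ₖ v_{k;m} xᵏ / k!`, a formal power series
(for `m ≥ 2` its radius of convergence is zero). -/
noncomputable def coverEGF (m : ℕ) : ℝ⟦X⟧ :=
  PowerSeries.mk fun k => (coverNumber k m : ℝ) / (k ! : ℝ)

/-- The value at `(z₁, …, z_m)` of `∑ ∏ⱼ (zⱼ choose lⱼ)`, summed over all `(l₁, …, l_m)` with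
`∑ j lⱼ = m` and `lⱼ ≤ zⱼ` for all `j`. The index `j ∈ {1, …, m}` is `(i : ℕ) + 1` for
`i : Fin m`. -/
def fixedSets (m : ℕ) (z : Fin m → ℕ) : ℕ :=
  ∑ l ∈ (Fintype.piFinset fun i : Fin m => Finset.range (z i + 1)) with
      ∑ i : Fin m, ((i : ℕ) + 1) * l i = m,
    ∏ i : Fin m, (z i).choose (l i)

/-- `γ_m(u) = [z^m] ∏ⱼ (1 + z^j)^{uⱼ}`. -/
noncomputable def gammaCoeff (m : ℕ) (u : Fin m → ℕ) : ℕ :=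
  (∏ i : Fin m, (1 + (Polynomial.X : Polynomial ℕ) ^ ((i : ℕ) + 1)) ^ u i).coeff m

/-- `∏ⱼ j^{-uⱼ} / uⱼ!`. -/
noncomputable def weight (m : ℕ) (u : Fin m → ℕ) : ℝ :=
  ∏ i : Fin m, ((((i : ℕ) : ℝ) + 1) ^ u i)⁻¹ / ((u i) ! : ℝ)

/-- `∑_{j = 1}^m 1 / j`. -/
noncomputable def harmonicSum (m : ℕ) : ℝ := ∑ i : Fin m, 1 / (((i : ℕ) : ℝ) + 1)

/-- The formal power series `e^{a x} = ∑ₖ aᵏ xᵏ / k!`. -/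
noncomputable def expMul (a : ℝ) : ℝ⟦X⟧ := PowerSeries.rescale a (PowerSeries.exp ℝ)

/-- The formal power series `e^f` of a formal power series `f` with arbitrary constant term
`c`, namely `e^c ∑ₙ (f - c)ⁿ / n!`. -/
noncomputable def expSeries (f : ℝ⟦X⟧) : ℝ⟦X⟧ :=
  PowerSeries.C (Real.exp (PowerSeries.constantCoeff f)) *
    (PowerSeries.exp ℝ).subst (f - PowerSeries.C (PowerSeries.constantCoeff f))

/-- The expectation of a random formal power series, taken coefficient by coefficient. -/
noncomputable def expectation {Ω : Type*} [MeasurableSpace Ω] (P : Measure Ω)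
    (F : Ω → ℝ⟦X⟧) : ℝ⟦X⟧ :=
  PowerSeries.mk fun k => ∫ ω, PowerSeries.coeff k (F ω) ∂P

end MCover

/-! Write `P_u = ∏ⱼ (1 + z^j)^{uⱼ}`, so that `𝓔_m = [z^m] P_Z` (`fixedSets_eq_gammaCoeff`). The
heart of the matter is the moment identity `E 𝓔_m^k = v_{k;m}` (`lintegral_gammaCoeff_pow`). It is
proved by letting the degree vary with the point: for `d : Fin k → ℕ` with entries at most `m`, the
number of covers of degree `d` is the mixed moment `E ∏ᵢ [z^{dᵢ}] P_Z`.

Both sides equal `1` at `d = 0` and satisfy `d_a N(d) = ∑ N(d - j 1_S)`, over `1 ≤ j ≤ m` and `S ∋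
a` with `dᵢ ≥ j` on `S`. For covers, count the members containing `a` and remove `j` copies of `S`.
For moments, extract `d_a [z^{d_a}] P_u` from `z P_u'`, shift `uⱼ` by the Poisson identity `E[Z f(Z
- 1)] = λ E[f(Z)]`, and expand the other factors using `P_{u + eⱼ} = P_u (1 + z^j)`; `S` records
which coefficients are lowered.

Working in `[0, ∞]` makes every rearrangement free; integrability then follows from finiteness of
the cover numbers. Summing moments over `k` gives the exponential identities. For `m = 2, 3`, `γ_m`
is linear in its last variable, and the inner sums are exponential series. -/

namespace MCover

/-! ### Covers of variable degree and their recursion -/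

section Recursion

open scoped ENNReal

variable {k : ℕ}

/-- The degree vector `d` with the entries indexed by `S` lowered by `n`. -/
def lower (d : Fin k → ℕ) (S : Finset (Fin k)) (n : ℕ) : Fin k → ℕ :=
  fun i => if i ∈ S then d i - n else d i

/-- A multiset of nonempty subsets of `[k]` such that `j` belongs to exactly `d j` of them. -/
def IsCoverOfDegree (d : Fin k → ℕ) (c : Multiset (Finset (Fin k))) : Prop :=
  (∀ s ∈ c, s.Nonempty) ∧ ∀ j : Fin k, c.countP (fun s => j ∈ s) = d j

open Classical in
/-- The number of covers of degree `d`. -/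
noncomputable def coverCount (d : Fin k → ℕ) : ℝ≥0∞ :=
  ∑' c : Multiset (Finset (Fin k)), if IsCoverOfDegree d c then 1 else 0

theorem coverNumber_eq_coverCount (k m : ℕ) :
    (coverNumber k m : ℝ≥0∞) = coverCount (fun _ : Fin k => m) := by
  classical
  have h1 : ∑' c : {c | IsCover k m c}, (1 : ℝ≥0∞) = coverCount (fun _ : Fin k => m) := by
    rw [tsum_subtype {c | IsCover k m c} (fun _ => (1 : ℝ≥0∞))]
    exact tsum_congr fun c => by rw [Set.indicator_apply]; rfl
  rw [← h1, ENNReal.tsum_set_one, coverNumber, ← (finite_setOf_isCover k m).cast_ncard_eq]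
  rfl

theorem coverCount_zero : coverCount (fun _ : Fin k => 0) = 1 := by
  classical
  rw [coverCount, tsum_eq_single 0]
  · rw [if_pos]
    exact ⟨by simp, by simp⟩
  · intro c hc
    rw [if_neg]
    rintro ⟨h1, h2⟩
    obtain ⟨s, hs⟩ := Multiset.exists_mem_of_ne_zero hc
    obtain ⟨j, hj⟩ := h1 s hs
    exact Multiset.countP_eq_zero.1 (h2 j) s hs hj

/-- The `n` added copies contribute `n` to the degree at each point of `S` and nothing elsewhere.
The bound `n ≤ d i` has to be recorded because `lower` truncates. -/
theorem isCoverOfDegree_add_replicate_iff (d : Fin k → ℕ) {S : Finset (Fin k)}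
    (hS : S.Nonempty) (n : ℕ) (c : Multiset (Finset (Fin k))) :
    IsCoverOfDegree d (c + Multiset.replicate n S) ↔
      (∀ i ∈ S, n ≤ d i) ∧ IsCoverOfDegree (lower d S n) c := by
  have hcount : ∀ j : Fin k, (c + Multiset.replicate n S).countP (fun s => j ∈ s) =
      c.countP (fun s => j ∈ s) + if j ∈ S then n else 0 := by
    intro j
    rw [Multiset.countP_add]
    congr 1
    split_ifs with h
    · rw [Multiset.countP_eq_card.2, Multiset.card_replicate]
      intro s hs
      rwa [Multiset.eq_of_mem_replicate hs]
    · rw [Multiset.countP_eq_zero]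
      intro s hs
      rwa [Multiset.eq_of_mem_replicate hs]
  constructor
  · rintro ⟨h1, h2⟩
    refine ⟨fun i hi => ?_, fun s hs => h1 s (Multiset.mem_add.2 (Or.inl hs)), fun j => ?_⟩
    · rw [← h2 i, hcount, if_pos hi]
      exact Nat.le_add_left _ _
    · have := h2 j
      rw [hcount] at this
      rw [lower, ← this]
      split_ifs <;> simp
  · rintro ⟨h1, h2, h3⟩
    refine ⟨fun s hs => ?_, fun j => ?_⟩
    · rcases Multiset.mem_add.1 hs with h | h
      · exact h2 s h
      · rwa [Multiset.eq_of_mem_replicate h]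
    · rw [hcount, h3, lower]
      split_ifs with h
      · exact Nat.sub_add_cancel (h1 j h)
      · rfl

theorem sum_fin_ite_succ_le {m n : ℕ} (h : n ≤ m) :
    ∑ j : Fin m, (if (j : ℕ) + 1 ≤ n then 1 else 0) = n := by
  rw [Fin.sum_univ_eq_sum_range (fun j => if j + 1 ≤ n then 1 else 0) m, Finset.sum_boole]
  have : (Finset.range m).filter (fun j => j + 1 ≤ n) = Finset.range n := by
    ext j
    simp only [Finset.mem_filter, Finset.mem_range]
    omega
  rw [this]
  simp

theorem countP_mem_eq_sum (a : Fin k) (c : Multiset (Finset (Fin k))) :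
    c.countP (fun s => a ∈ s) = ∑ S : Finset (Fin k), if a ∈ S then c.count S else 0 := by
  induction c using Multiset.induction_on with
  | empty => simp
  | cons s c ih =>
    rw [Multiset.countP_cons, ih]
    simp_rw [Multiset.count_cons]
    rw [show (if a ∈ s then 1 else 0) = ∑ S : Finset (Fin k), if S = s then (if a ∈ S then 1 else 0)
      else 0 by simp, ← Finset.sum_add_distrib]
    refine Finset.sum_congr rfl fun S _ => ?_
    split_ifs <;> simp

/-- Layer-cake form: a multiplicity is the number of `j ≥ 1` not exceeding it. No set containing `a`
occurs more than `m` times, so `j ≤ m` suffices. -/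
theorem countP_mem_eq_sum_ite {m : ℕ} (a : Fin k) (c : Multiset (Finset (Fin k)))
    (h : c.countP (fun s => a ∈ s) ≤ m) :
    c.countP (fun s => a ∈ s) = ∑ j : Fin m, ∑ S : Finset (Fin k),
      if a ∈ S ∧ (j : ℕ) + 1 ≤ c.count S then 1 else 0 := by
  rw [Finset.sum_comm, countP_mem_eq_sum a c]
  refine Finset.sum_congr rfl fun S _ => ?_
  by_cases ha : a ∈ S
  · simp only [ha, true_and, if_true]
    refine (sum_fin_ite_succ_le (le_trans ?_ h)).symm
    rw [countP_mem_eq_sum a c]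
    refine le_trans (by rw [if_pos ha]) (Finset.single_le_sum
      (f := fun S => if a ∈ S then c.count S else 0) (fun _ _ => Nat.zero_le _)
      (Finset.mem_univ S))
  · simp [ha]

/-- Counting pairs consisting of a cover and of one of its members containing `a`. -/
theorem coverCount_recursion {m : ℕ} (d : Fin k → ℕ) (a : Fin k) (h : d a ≤ m) :
    (d a : ℝ≥0∞) * coverCount d = ∑ j : Fin m, ∑ S : Finset (Fin k),
      if a ∈ S ∧ ∀ i ∈ S, (j : ℕ) + 1 ≤ d i then coverCount (lower d S (j + 1)) else 0 := by
  classical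
  have h1 : (d a : ℝ≥0∞) * coverCount d = ∑' c : Multiset (Finset (Fin k)),
      ∑ j : Fin m, ∑ S : Finset (Fin k),
        if IsCoverOfDegree d c ∧ a ∈ S ∧ (j : ℕ) + 1 ≤ c.count S then (1 : ℝ≥0∞) else 0 := by
    rw [coverCount, ← ENNReal.tsum_mul_left]
    refine tsum_congr fun c => ?_
    by_cases hc : IsCoverOfDegree d c
    · simp only [hc, if_true, mul_one, true_and]
      have h2 := countP_mem_eq_sum_ite (m := m) a c (by rw [hc.2]; exact h)
      rw [hc.2] at h2
      rw [h2]
      push_cast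
      rfl
    · simp [hc]
  rw [h1, Summable.tsum_finsetSum (fun _ _ => ENNReal.summable)]
  refine Finset.sum_congr rfl fun j _ => ?_
  rw [Summable.tsum_finsetSum (fun _ _ => ENNReal.summable)]
  refine Finset.sum_congr rfl fun S _ => ?_
  by_cases ha : a ∈ S
  swap
  · simp [ha]
  have hinj : Function.Injective
      fun c : Multiset (Finset (Fin k)) => c + Multiset.replicate ((j : ℕ) + 1) S :=
    add_left_injective _
  -- Covers containing `S` at least `j + 1` times are exactly those of the form `c + (j + 1) • {S}`;
  -- sum over `c` instead.
  rw [← hinj.tsum_eq]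
  · simp only [isCoverOfDegree_add_replicate_iff d ⟨a, ha⟩, ha, true_and, Multiset.count_add,
      Multiset.count_replicate_self, Nat.le_add_left, and_true]
    by_cases hd : ∀ i ∈ S, (j : ℕ) + 1 ≤ d i
    · rw [if_pos hd, coverCount]
      exact tsum_congr fun c => by simp only [and_iff_right hd]
    · rw [if_neg hd]
      exact ENNReal.tsum_eq_zero.2 fun c => if_neg fun h => hd h.1
  · intro c hc
    rw [Function.mem_support, ne_eq, ite_eq_right_iff, Classical.not_imp] at hc
    obtain ⟨e, he⟩ := Multiset.le_iff_exists_add.1 (Multiset.le_count_iff_replicate_le.1 hc.1.2.2)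
    exact ⟨e, (add_comm _ _).trans he.symm⟩

end Recursion

/-! ### Mixed Poisson moments satisfy the same recursion -/

section PoissonMoments

open Polynomial

variable {m : ℕ}

/-- The polynomial `∏ⱼ (1 + z^j)^{uⱼ}`. -/
noncomputable def cyclePoly (u : Fin m → ℕ) : ℕ[X] :=
  ∏ i : Fin m, (1 + (X : ℕ[X]) ^ ((i : ℕ) + 1)) ^ u i

theorem gammaCoeff_eq_coeff_cyclePoly (u : Fin m → ℕ) :
    gammaCoeff m u = (cyclePoly u).coeff m := rfl

theorem cyclePoly_add_single (u : Fin m → ℕ) (j : Fin m) :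
    cyclePoly (u + Pi.single j 1) = cyclePoly u * (1 + X ^ ((j : ℕ) + 1)) := by
  simp only [cyclePoly, Pi.add_apply, pow_add, Finset.prod_mul_distrib]
  congr 1
  rw [Finset.prod_eq_single j]
  · simp
  · intro i _ hi
    simp [Pi.single_eq_of_ne hi]
  · simp

theorem coeff_cyclePoly_add_single (u : Fin m → ℕ) (j : Fin m) (d : ℕ) :
    (cyclePoly (u + Pi.single j 1)).coeff d = (cyclePoly u).coeff d +
      if (j : ℕ) + 1 ≤ d then (cyclePoly u).coeff (d - (j + 1)) else 0 := by
  rw [cyclePoly_add_single, mul_add, mul_one, coeff_add, coeff_mul_X_pow']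

theorem cyclePoly_sub_single (u : Fin m → ℕ) (j : Fin m) :
    cyclePoly (u - Pi.single j 1) =
      (∏ i ∈ Finset.univ.erase j, (1 + (X : ℕ[X]) ^ ((i : ℕ) + 1)) ^ u i) *
        (1 + X ^ ((j : ℕ) + 1)) ^ (u j - 1) := by
  rw [cyclePoly, ← Finset.prod_erase_mul _ _ (Finset.mem_univ j)]
  congr 1
  · refine Finset.prod_congr rfl fun i hi => ?_
    simp [Pi.single_eq_of_ne (Finset.ne_of_mem_erase hi)]
  · simp

/-- Product rule. The truncation in `u - Pi.single j 1` is harmless: when `u j = 0` the factor `u j`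
kills the term. -/
theorem X_mul_derivative_cyclePoly (u : Fin m → ℕ) :
    X * derivative (cyclePoly u) = ∑ j : Fin m,
      C (((j : ℕ) + 1) * u j) * (cyclePoly (u - Pi.single j 1) * X ^ ((j : ℕ) + 1)) := by
  rw [cyclePoly, derivative_prod_finset, Finset.mul_sum]
  refine Finset.sum_congr rfl fun j _ => ?_
  rw [cyclePoly_sub_single, derivative_pow, derivative_add, derivative_one, derivative_X_pow,
    map_mul, map_add, map_one]
  simp only [eq_natCast]
  push_cast
  ring

theorem natCast_mul_coeff_cyclePoly (u : Fin m → ℕ) (d : ℕ) :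
    d * (cyclePoly u).coeff d = ∑ j : Fin m, if (j : ℕ) + 1 ≤ d then
      ((j : ℕ) + 1) * u j * (cyclePoly (u - Pi.single j 1)).coeff (d - (j + 1)) else 0 := by
  have h := congrArg (fun p => coeff p d) (X_mul_derivative_cyclePoly u)
  simp only [finsetSum_coeff, coeff_C_mul, coeff_mul_X_pow'] at h
  have h2 : (X * derivative (cyclePoly u)).coeff d = d * (cyclePoly u).coeff d := by
    cases d with
    | zero => simp
    | succ n => rw [coeff_X_mul, coeff_derivative, mul_comm]; push_cast; rfl
  rw [← h2, h]
  exact Finset.sum_congr rfl fun j _ => by split_ifs <;> simp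

theorem weight_nonneg (u : Fin m → ℕ) : 0 ≤ weight m u :=
  Finset.prod_nonneg fun _ _ => by positivity

theorem weight_add_single (u : Fin m → ℕ) (j : Fin m) :
    weight m (u + Pi.single j 1) * ((((j : ℕ) : ℝ) + 1) * ((u j : ℝ) + 1)) = weight m u := by
  rw [weight, weight, ← Finset.prod_erase_mul _ _ (Finset.mem_univ j),
    ← Finset.prod_erase_mul _ _ (Finset.mem_univ j), mul_assoc]
  congr 1
  · refine Finset.prod_congr rfl fun i hi => ?_
    simp [Pi.single_eq_of_ne (Finset.ne_of_mem_erase hi)]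
  · simp only [Pi.add_apply, Pi.single_eq_same, Nat.factorial_succ, pow_succ]
    push_cast
    have := (Nat.cast_pos (α := ℝ)).2 (Nat.factorial_pos (u j))
    have h2 : (((j : ℕ) : ℝ) + 1) ≠ 0 := by positivity
    field_simp

theorem ofReal_weight_add_single (u : Fin m → ℕ) (j : Fin m) :
    ENNReal.ofReal (weight m (u + Pi.single j 1)) * (((j : ℕ) + 1) * (u j + 1) : ℕ) =
      ENNReal.ofReal (weight m u) := by
  rw [← weight_add_single u j, ENNReal.ofReal_mul (weight_nonneg _), ← ENNReal.ofReal_natCast]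
  push_cast
  rfl

open scoped ENNReal

variable {k : ℕ}

/-- The sum over `u` of the product of the coefficients of order `d i` of `∏ⱼ (1 + z^j)^{uⱼ}`,
weighted by `∏ⱼ j^{-uⱼ} / uⱼ!`. -/
noncomputable def poissonMoment (m : ℕ) (d : Fin k → ℕ) : ℝ≥0∞ :=
  ∑' u : Fin m → ℕ, ENNReal.ofReal (weight m u) * ∏ i, ((cyclePoly u).coeff (d i) : ℝ≥0∞)

/-- The form taken by the identity `E[Z f(Z - 1)] = λ E[f(Z)]`, for `Z` Poisson of parameter
`λ`. -/
theorem tsum_weight_mul_shift (j : Fin m) (f : (Fin m → ℕ) → ℝ≥0∞) :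
    ∑' u : Fin m → ℕ, ENNReal.ofReal (weight m u) *
      ((((j : ℕ) + 1) * u j : ℕ) * f (u - Pi.single j 1)) =
    ∑' u : Fin m → ℕ, ENNReal.ofReal (weight m u) * f u := by
  have hinj : Function.Injective fun u : Fin m → ℕ => u + Pi.single j 1 := add_left_injective _
  -- Terms with `u j = 0` vanish, so the sum may be taken over shifted vectors `u + eⱼ`.
  rw [← hinj.tsum_eq]
  · refine tsum_congr fun u => ?_
    rw [← mul_assoc, add_tsub_cancel_right]
    congr 1
    simpa using ofReal_weight_add_single u j
  · intro u hu
    refine ⟨u - Pi.single j 1, tsub_add_cancel_of_le fun i => ?_⟩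
    rcases eq_or_ne i j with rfl | hi
    · rw [Pi.single_eq_same, Nat.one_le_iff_ne_zero]
      rintro h
      simp [h] at hu
    · simp [Pi.single_eq_of_ne hi]

theorem poissonMoment_recursion (d : Fin k → ℕ) (a : Fin k) :
    (d a : ℝ≥0∞) * poissonMoment m d = ∑ j : Fin m, ∑ S : Finset (Fin k),
      if a ∈ S ∧ ∀ i ∈ S, (j : ℕ) + 1 ≤ d i then poissonMoment m (lower d S (j + 1)) else 0 := by
  have h1 : ∀ u : Fin m → ℕ, (d a : ℝ≥0∞) * ∏ i, ((cyclePoly u).coeff (d i) : ℝ≥0∞) =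
      ∑ j : Fin m, (((j : ℕ) + 1) * u j : ℕ) * if (j : ℕ) + 1 ≤ d a then
        ((cyclePoly (u - Pi.single j 1)).coeff (d a - (j + 1)) : ℝ≥0∞) *
          ∏ i ∈ Finset.univ.erase a, ((cyclePoly u).coeff (d i) : ℝ≥0∞) else 0 := by
    intro u
    rw [← Finset.mul_prod_erase _ _ (Finset.mem_univ a), ← mul_assoc, ← Nat.cast_mul,
      natCast_mul_coeff_cyclePoly, Nat.cast_sum, Finset.sum_mul]
    refine Finset.sum_congr rfl fun j _ => ?_
    split_ifs <;> simp [mul_assoc]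
  have h2 : ∀ (j : Fin m) (u : Fin m → ℕ),
      (if (j : ℕ) + 1 ≤ d a then ((cyclePoly u).coeff (d a - (j + 1)) : ℝ≥0∞) *
        ∏ i ∈ Finset.univ.erase a, ((cyclePoly (u + Pi.single j 1)).coeff (d i) : ℝ≥0∞) else 0) =
      ∑ S : Finset (Fin k), if a ∈ S ∧ ∀ i ∈ S, (j : ℕ) + 1 ≤ d i then
        ∏ i, ((cyclePoly u).coeff (lower d S (j + 1) i) : ℝ≥0∞) else 0 := by
    intro j u
    -- Each factor is "lowered + unlowered"; at `i = a` the unlowered part is set to zero, so that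
    -- expanding the product leaves only sets `S` containing `a`.
    have h3 : (if (j : ℕ) + 1 ≤ d a then ((cyclePoly u).coeff (d a - (j + 1)) : ℝ≥0∞) *
        ∏ i ∈ Finset.univ.erase a, ((cyclePoly (u + Pi.single j 1)).coeff (d i) : ℝ≥0∞) else 0) =
        ∏ i, ((if (j : ℕ) + 1 ≤ d i then ((cyclePoly u).coeff (d i - (j + 1)) : ℝ≥0∞) else 0) +
          if i = a then 0 else ((cyclePoly u).coeff (d i) : ℝ≥0∞)) := by
      rw [← Finset.mul_prod_erase _ _ (Finset.mem_univ a), if_pos rfl, add_zero, ite_mul, zero_mul]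
      congr 2
      refine Finset.prod_congr rfl fun i hi => ?_
      rw [if_neg (Finset.ne_of_mem_erase hi), coeff_cyclePoly_add_single, add_comm]
      push_cast
      rfl
    rw [h3, Finset.prod_add, Finset.powerset_univ]
    refine Finset.sum_congr rfl fun S _ => ?_
    split_ifs with h
    · rw [← Finset.prod_mul_prod_compl S, Finset.compl_eq_univ_sdiff]
      congr 1
      · exact Finset.prod_congr rfl fun i hi => by rw [if_pos (h.2 i hi), lower, if_pos hi]
      · refine Finset.prod_congr rfl fun i hi => ?_
        have hi' : i ∉ S := (Finset.mem_sdiff.1 hi).2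
        rw [if_neg (fun e : i = a => hi' (e ▸ h.1)), lower, if_neg hi']
    · by_cases ha : a ∈ S
      · obtain ⟨i, hi, hi'⟩ : ∃ i ∈ S, ¬ (j : ℕ) + 1 ≤ d i := by
          by_contra! hcon
          exact h ⟨ha, hcon⟩
        refine mul_eq_zero_of_left ?_ _
        exact Finset.prod_eq_zero hi (if_neg hi')
      · refine mul_eq_zero_of_right _ ?_
        exact Finset.prod_eq_zero (Finset.mem_sdiff.2 ⟨Finset.mem_univ a, ha⟩) (if_pos rfl)
  -- The summand is written as a function of `u - eⱼ`, as the Poisson shift requires: the factors `i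
  -- ≠ a`, which involve `u`, become those of `(u - eⱼ) + eⱼ`.
  obtain ⟨G, hG⟩ : ∃ G : Fin m → (Fin m → ℕ) → ℝ≥0∞, ∀ j u, G j u =
      if (j : ℕ) + 1 ≤ d a then ((cyclePoly u).coeff (d a - (j + 1)) : ℝ≥0∞) *
        ∏ i ∈ Finset.univ.erase a, ((cyclePoly (u + Pi.single j 1)).coeff (d i) : ℝ≥0∞) else 0 :=
    ⟨_, fun _ _ => rfl⟩
  calc (d a : ℝ≥0∞) * poissonMoment m d
      = ∑' u : Fin m → ℕ, ∑ j : Fin m, ENNReal.ofReal (weight m u) *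
          ((((j : ℕ) + 1) * u j : ℕ) * G j (u - Pi.single j 1)) := by
        rw [poissonMoment, ← ENNReal.tsum_mul_left]
        refine tsum_congr fun u => ?_
        rw [mul_left_comm, h1, Finset.mul_sum]
        refine Finset.sum_congr rfl fun j _ => ?_
        rw [hG]
        rcases Nat.eq_zero_or_pos (u j) with h0 | h0
        · simp [h0]
        · rw [tsub_add_cancel_of_le]
          intro i
          rcases eq_or_ne i j with rfl | hi
          · simpa [Nat.one_le_iff_ne_zero] using h0.ne'
          · simp [Pi.single_eq_of_ne hi]
    _ = _ := by
        rw [Summable.tsum_finsetSum (fun _ _ => ENNReal.summable)]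
        refine Finset.sum_congr rfl fun j _ => ?_
        rw [tsum_weight_mul_shift j (G j)]
        simp_rw [hG]
        simp_rw [h2 j, Finset.mul_sum]
        rw [Summable.tsum_finsetSum (fun _ _ => ENNReal.summable)]
        refine Finset.sum_congr rfl fun S _ => ?_
        split_ifs with h
        · rfl
        · simp

theorem coeff_zero_cyclePoly (u : Fin m → ℕ) : (cyclePoly u).coeff 0 = 1 := by
  rw [coeff_zero_eq_eval_zero, cyclePoly, eval_prod]
  simp

/-- Induction on the total degree, the two recursions being identical. The bound by `m` is what
makes the parts `j ≤ m` sufficient for covers; the last factor is the missing normalisation. -/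
theorem poissonMoment_eq (d : Fin k → ℕ) (hd : ∀ i, d i ≤ m) :
    poissonMoment m d = coverCount d * ∑' u : Fin m → ℕ, ENNReal.ofReal (weight m u) := by
  induction hn : ∑ i, d i using Nat.strong_induction_on generalizing d with
  | _ n ih =>
    by_cases h0 : ∃ a, d a ≠ 0
    · obtain ⟨a, ha⟩ := h0
      refine (ENNReal.mul_right_inj (Nat.cast_ne_zero.2 ha) (ENNReal.natCast_ne_top (d a))).1 ?_
      rw [← mul_assoc, coverCount_recursion d a (hd a), poissonMoment_recursion, Finset.sum_mul]
      refine Finset.sum_congr rfl fun j _ => ?_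
      rw [Finset.sum_mul]
      refine Finset.sum_congr rfl fun S _ => ?_
      split_ifs with h
      · have hle : ∀ i, lower d S (j + 1) i ≤ d i := fun i => by
          unfold lower
          split_ifs
          · exact Nat.sub_le _ _
          · exact le_rfl
        refine ih _ ?_ _ (fun i => (hle i).trans (hd i)) rfl
        rw [← hn]
        refine Finset.sum_lt_sum (fun i _ => hle i) ⟨a, Finset.mem_univ a, ?_⟩
        rw [lower, if_pos h.1]
        omega
      · simp
    · push Not at h0
      obtain rfl : d = fun _ => 0 := funext h0
      simp [poissonMoment, coverCount_zero, coeff_zero_cyclePoly]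

end PoissonMoments

/-! ### The joint Poisson law, its moments and exponential moments -/

section Law

open scoped ENNReal

variable {m : ℕ}

theorem fixedSets_eq_gammaCoeff (m : ℕ) (z : Fin m → ℕ) : fixedSets m z = gammaCoeff m z := by
  have h : cyclePoly z = ∑ l ∈ Fintype.piFinset fun i : Fin m => Finset.range (z i + 1),
      (∏ i : Fin m, (z i).choose (l i)) •
        (Polynomial.X : Polynomial ℕ) ^ ∑ i : Fin m, ((i : ℕ) + 1) * l i := by
    rw [cyclePoly]
    simp_rw [add_comm (1 : Polynomial ℕ), add_pow, one_pow, mul_one, Finset.prod_univ_sum]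
    refine Finset.sum_congr rfl fun l _ => ?_
    rw [Finset.prod_mul_distrib, nsmul_eq_mul, Nat.cast_prod, mul_comm]
    simp_rw [← pow_mul]
    rw [Finset.prod_pow_eq_pow_sum]
  rw [gammaCoeff_eq_coeff_cyclePoly, h, Polynomial.finsetSum_coeff, fixedSets, Finset.sum_filter]
  refine Finset.sum_congr rfl fun l _ => ?_
  rw [Polynomial.coeff_smul, Polynomial.coeff_X_pow]
  by_cases hl : ∑ i : Fin m, ((i : ℕ) + 1) * l i = m
  · simp [hl]
  · simp [hl, Ne.symm hl]

/-- The joint law of independent Poisson variables of parameters `1, 1/2, …, 1/m`. -/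
noncomputable def jointLaw (m : ℕ) : Measure (Fin m → ℕ) :=
  Measure.pi fun i => poissonMeasure (1 / (((i : ℕ) : NNReal) + 1))

instance : IsProbabilityMeasure (jointLaw m) := by
  unfold jointLaw
  infer_instance

theorem jointLaw_singleton (u : Fin m → ℕ) :
    jointLaw m {u} = ENNReal.ofReal (Real.exp (-harmonicSum m)) * ENNReal.ofReal (weight m u) := by
  rw [jointLaw, ← Set.univ_pi_singleton, Measure.pi_pi]
  simp_rw [poissonMeasure_singleton]
  rw [← ENNReal.ofReal_prod_of_nonneg (fun _ _ => by positivity),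
    ← ENNReal.ofReal_mul (Real.exp_pos _).le, weight, harmonicSum, ← Finset.sum_neg_distrib,
    Real.exp_sum, ← Finset.prod_mul_distrib]
  congr 1
  refine Finset.prod_congr rfl fun i _ => ?_
  push_cast
  rw [one_div, inv_pow, mul_div_assoc]

theorem lintegral_jointLaw (f : (Fin m → ℕ) → ℝ≥0∞) :
    ∫⁻ u, f u ∂jointLaw m = ENNReal.ofReal (Real.exp (-harmonicSum m)) *
      ∑' u, ENNReal.ofReal (weight m u) * f u := by
  rw [lintegral_countable', ← ENNReal.tsum_mul_left]
  refine tsum_congr fun u => ?_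
  rw [jointLaw_singleton]
  ring

theorem ofReal_exp_neg_mul_tsum_weight (m : ℕ) :
    ENNReal.ofReal (Real.exp (-harmonicSum m)) *
      ∑' u : Fin m → ℕ, ENNReal.ofReal (weight m u) = 1 := by
  simpa using (lintegral_jointLaw (m := m) fun _ => 1).symm

/-- The moments of the number of fixed sets of the Poisson cycle counts are the numbers of
covers. -/
theorem lintegral_gammaCoeff_pow (m k : ℕ) :
    ∫⁻ u, (gammaCoeff m u : ℝ≥0∞) ^ k ∂jointLaw m = coverNumber k m := by
  have h := poissonMoment_eq (fun _ : Fin k => m) (fun _ => le_refl m)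
  rw [poissonMoment, ← coverNumber_eq_coverCount] at h
  simp only [Finset.prod_const, Finset.card_univ, Fintype.card_fin,
    ← gammaCoeff_eq_coeff_cyclePoly] at h
  rw [lintegral_jointLaw, h, mul_left_comm, ofReal_exp_neg_mul_tsum_weight, mul_one]

theorem integrable_jointLaw {g : (Fin m → ℕ) → ℝ} (hg : ∀ u, 0 ≤ g u)
    (h : ∫⁻ u, ENNReal.ofReal (g u) ∂jointLaw m ≠ ∞) : Integrable g (jointLaw m) := by
  refine ⟨Measurable.of_discrete.aestronglyMeasurable, ?_⟩
  rw [hasFiniteIntegral_iff_ofReal (Filter.Eventually.of_forall hg)]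
  exact h.lt_top

theorem hasSum_integral_jointLaw {g : (Fin m → ℕ) → ℝ} (hg : Integrable g (jointLaw m)) :
    HasSum (fun u => weight m u * g u) (Real.exp (harmonicSum m) * ∫ u, g u ∂jointLaw m) := by
  have hs : ∀ u, (jointLaw m).real {u} = Real.exp (-harmonicSum m) * weight m u := fun u => by
    rw [measureReal_def, jointLaw_singleton, ENNReal.toReal_mul,
      ENNReal.toReal_ofReal (Real.exp_pos _).le, ENNReal.toReal_ofReal (weight_nonneg u)]
  have h := (hasSum_integral_iUnion (s := fun u : Fin m → ℕ => {u})
    (fun u => measurableSet_singleton u) (fun u v huv => by simpa using huv)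
    (f := g) (μ := jointLaw m) hg.integrableOn).mul_left (Real.exp (harmonicSum m))
  rw [Set.iUnion_of_singleton, setIntegral_univ] at h
  refine h.congr_fun fun u => ?_
  rw [integral_singleton, hs, smul_eq_mul, Real.exp_neg]
  field_simp

theorem lintegral_ofReal_gammaCoeff_pow (m k : ℕ) (x : ℝ) (hx : 0 ≤ x) :
    ∫⁻ u, ENNReal.ofReal ((gammaCoeff m u : ℝ) ^ k / (k ! : ℝ) * x ^ k) ∂jointLaw m =
      ENNReal.ofReal ((coverNumber k m : ℝ) / (k ! : ℝ) * x ^ k) := by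
  have h : ∀ y : ℕ, ENNReal.ofReal ((y : ℝ) / (k ! : ℝ) * x ^ k) =
      ENNReal.ofReal (x ^ k / (k ! : ℝ)) * y := fun y => by
    rw [← ENNReal.ofReal_natCast, ← ENNReal.ofReal_mul (by positivity)]
    congr 1
    ring
  rw [h, ← lintegral_gammaCoeff_pow, ← lintegral_const_mul _ Measurable.of_discrete]
  refine lintegral_congr fun u => ?_
  rw [← Nat.cast_pow, h, Nat.cast_pow]

theorem integrable_gammaCoeff_pow (m k : ℕ) :
    Integrable (fun u => (gammaCoeff m u : ℝ) ^ k / (k ! : ℝ)) (jointLaw m) := by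
  refine integrable_jointLaw (fun u => by positivity) ?_
  have h := lintegral_ofReal_gammaCoeff_pow m k 1 zero_le_one
  simp only [one_pow, mul_one] at h
  rw [h]
  exact ENNReal.ofReal_ne_top

theorem integral_gammaCoeff_pow (m k : ℕ) :
    ∫ u, (gammaCoeff m u : ℝ) ^ k / (k ! : ℝ) ∂jointLaw m = (coverNumber k m : ℝ) / (k ! : ℝ) := by
  have h := lintegral_ofReal_gammaCoeff_pow m k 1 zero_le_one
  simp only [one_pow, mul_one] at h
  rw [integral_eq_lintegral_of_nonneg_ae (Filter.Eventually.of_forall fun u => by positivity)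
    Measurable.of_discrete.aestronglyMeasurable, h, ENNReal.toReal_ofReal (by positivity)]

/-- Tonelli for the exponential series, whose terms are nonnegative when `x ≥ 0`. -/
theorem lintegral_exp_gammaCoeff (m : ℕ) (x : ℝ) (hx : 0 ≤ x) :
    ∫⁻ u, ENNReal.ofReal (Real.exp (x * (gammaCoeff m u : ℝ))) ∂jointLaw m =
      ∑' k : ℕ, ENNReal.ofReal ((coverNumber k m : ℝ) / (k ! : ℝ) * x ^ k) := by
  simp_rw [← lintegral_ofReal_gammaCoeff_pow m _ x hx]
  rw [← lintegral_tsum fun k => Measurable.of_discrete.aemeasurable]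
  refine lintegral_congr fun u => ?_
  have h := NormedSpace.expSeries_div_hasSum_exp (x * (gammaCoeff m u : ℝ))
  rw [← Real.exp_eq_exp_ℝ] at h
  rw [← ENNReal.ofReal_tsum_of_nonneg (fun k => by positivity)]
  · rw [← h.tsum_eq]
    congr 1
    exact tsum_congr fun k => by ring
  · exact h.summable.congr fun k => by ring

/-- Domination by the case `|x|`: real summability is absolute and the coefficients are nonnegative,
so the series also converges at `|x|`. -/
theorem integrable_exp_gammaCoeff {x : ℝ}
    (hx : Summable fun k : ℕ => (coverNumber k m : ℝ) / (k ! : ℝ) * x ^ k) :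
    Integrable (fun u => Real.exp (x * (gammaCoeff m u : ℝ))) (jointLaw m) := by
  refine integrable_jointLaw (fun u => (Real.exp_pos _).le) (ne_top_of_le_ne_top
    (b := ∫⁻ u, ENNReal.ofReal (Real.exp (|x| * (gammaCoeff m u : ℝ))) ∂jointLaw m) ?_ ?_)
  · rw [lintegral_exp_gammaCoeff m |x| (abs_nonneg x),
      ← ENNReal.ofReal_tsum_of_nonneg (fun k => by positivity)]
    · exact ENNReal.ofReal_ne_top
    · refine hx.abs.congr fun k => ?_
      rw [abs_mul, abs_pow, abs_of_nonneg (by positivity : 0 ≤ (coverNumber k m : ℝ) / (k ! : ℝ))]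
  · refine lintegral_mono fun u => ENNReal.ofReal_le_ofReal (Real.exp_le_exp.2 ?_)
    exact mul_le_mul_of_nonneg_right (le_abs_self x) (Nat.cast_nonneg _)

theorem integral_exp_gammaCoeff {x : ℝ}
    (hx : Summable fun k : ℕ => (coverNumber k m : ℝ) / (k ! : ℝ) * x ^ k) :
    ∑' k : ℕ, (coverNumber k m : ℝ) / (k ! : ℝ) * x ^ k =
      ∫ u, Real.exp (x * (gammaCoeff m u : ℝ)) ∂jointLaw m := by
  have h := integral_tsum_of_summable_integral_norm (μ := jointLaw m)
    (F := fun (k : ℕ) u => (gammaCoeff m u : ℝ) ^ k / (k ! : ℝ) * x ^ k)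
    (fun k => (integrable_gammaCoeff_pow m k).mul_const _) ?_
  · simp_rw [integral_mul_const, integral_gammaCoeff_pow] at h
    rw [h]
    refine integral_congr_ae (Filter.Eventually.of_forall fun u => ?_)
    have h2 := NormedSpace.expSeries_div_hasSum_exp (x * (gammaCoeff m u : ℝ))
    rw [← Real.exp_eq_exp_ℝ] at h2
    simp only
    rw [← h2.tsum_eq]
    exact tsum_congr fun k => by ring
  · refine hx.abs.congr fun k => ?_
    rw [abs_mul, ← integral_gammaCoeff_pow, abs_of_nonneg (integral_nonneg fun u => by positivity),
      ← integral_mul_const]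
    refine integral_congr_ae (Filter.Eventually.of_forall fun u => ?_)
    simp only
    rw [norm_mul, Real.norm_eq_abs, Real.norm_eq_abs,
      abs_of_nonneg (by positivity : 0 ≤ (gammaCoeff m u : ℝ) ^ k / (k ! : ℝ))]

end Law

/-! ### Formal exponentials and explicit coefficients -/

section FormalSeries

open PowerSeries

variable {m : ℕ}

theorem coeff_expMul (a : ℝ) (k : ℕ) : coeff k (expMul a) = a ^ k / (k ! : ℝ) := by
  rw [expMul, coeff_rescale, coeff_exp]
  simp [div_eq_mul_inv]

theorem expMul_add (a b : ℝ) : expMul (a + b) = expMul a * expMul b :=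
  (exp_mul_exp_eq_exp_add a b).symm

theorem expMul_pow (a : ℝ) (n : ℕ) : expMul a ^ n = expMul (n * a) := by
  induction n with
  | zero =>
    ext k
    rw [pow_zero, coeff_expMul, coeff_one]
    rcases eq_or_ne k 0 with rfl | hk <;> simp [*]
  | succ n ih => rw [pow_succ, ih, ← expMul_add]; push_cast; congr 1; ring

/-- The exponential of a formal power series is given by the exponential series. -/
theorem hasSum_expSeries (f : ℝ⟦X⟧) :
    HasSum (fun n : ℕ => C (1 / (n ! : ℝ)) * f ^ n) (expSeries f) := by
  rw [WithPiTopology.hasSum_iff_hasSum_coeff]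
  intro d
  obtain ⟨c, hc⟩ : ∃ c, c = constantCoeff f := ⟨_, rfl⟩
  -- Since `g` has no constant term, `[x^d] g^n = 0` for `n > d`. The claim becomes the Cauchy
  -- product of the series of `e^c` with a finite sum, by the binomial theorem for `(c + g)^n`.
  obtain ⟨g, hg⟩ : ∃ g, g = f - C c := ⟨_, rfl⟩
  have hg0 : constantCoeff g = 0 := by rw [hg, hc]; simp
  have hsub : HasSubst g := HasSubst.of_constantCoeff_zero' hg0
  have hzero : ∀ n, n ∉ Finset.range (d + 1) → (n ! : ℝ)⁻¹ * coeff d (g ^ n) = 0 := by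
    intro n hn
    rw [coeff_of_lt_order, mul_zero]
    refine lt_of_lt_of_le ?_ (le_order_pow_of_constantCoeff_eq_zero n hg0)
    rw [Finset.mem_range, not_lt] at hn
    exact_mod_cast hn
  have hsumg : Summable fun n : ℕ => (n ! : ℝ)⁻¹ * coeff d (g ^ n) :=
    summable_of_ne_finset_zero hzero
  have hsumc : HasSum (fun n : ℕ => c ^ n / (n ! : ℝ)) (Real.exp c) := by
    rw [Real.exp_eq_exp_ℝ]
    exact NormedSpace.expSeries_div_hasSum_exp c
  have hval : coeff d (expSeries f) =
      Real.exp c * ∑' n : ℕ, (n ! : ℝ)⁻¹ * coeff d (g ^ n) := by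
    rw [expSeries, ← hc, ← hg, coeff_C_mul, coeff_subst' hsub, tsum_eq_finsum]
    · simp [coeff_exp]
    · refine (Finset.range (d + 1)).finite_toSet.subset fun n hn => ?_
      by_contra hn'
      exact hn (hzero n hn')
  have hprod := tsum_mul_tsum_eq_tsum_sum_antidiagonal_of_summable_norm hsumc.summable.norm
    hsumg.norm
  have hterm : ∀ n : ℕ, ∑ kl ∈ Finset.HasAntidiagonal.antidiagonal n,
      c ^ kl.1 / (kl.1 ! : ℝ) * ((kl.2 ! : ℝ)⁻¹ * coeff d (g ^ kl.2)) =
        coeff d (C (1 / (n ! : ℝ)) * f ^ n) := by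
    intro n
    rw [show f = C c + g by rw [hg]; ring, (Commute.all _ _).add_pow', coeff_C_mul, map_sum,
      Finset.mul_sum]
    refine Finset.sum_congr rfl fun kl hkl => ?_
    rw [Finset.HasAntidiagonal.mem_antidiagonal] at hkl
    rw [← hkl, map_nsmul, ← map_pow, coeff_C_mul, nsmul_eq_mul, Nat.cast_add_choose]
    have h1 : ((kl.1 + kl.2)! : ℝ) ≠ 0 := Nat.cast_ne_zero.2 (Nat.factorial_ne_zero _)
    field_simp
  have hsum := (summable_norm_sum_mul_antidiagonal_of_summable_norm hsumc.summable.norm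
    hsumg.norm).of_norm
  rw [hval, ← hsumc.tsum_eq, hprod]
  simp_rw [hterm] at hsum ⊢
  exact hsum.hasSum

theorem constantCoeff_expSeries (f : ℝ⟦X⟧) :
    constantCoeff (expSeries f) = Real.exp (constantCoeff f) := by
  have h := (WithPiTopology.hasSum_iff_hasSum_coeff ℝ).1 (hasSum_expSeries f) 0
  have h2 := NormedSpace.expSeries_div_hasSum_exp (constantCoeff f)
  rw [← Real.exp_eq_exp_ℝ] at h2
  rw [← coeff_zero_eq_constantCoeff_apply (expSeries f)]
  refine h.unique (h2.congr_fun fun n => ?_)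
  rw [coeff_C_mul, coeff_zero_eq_constantCoeff_apply, map_pow]
  ring

theorem hasSum_expSeries_C_mul_expMul (c a : ℝ) :
    HasSum (fun n : ℕ => C (c ^ n / (n ! : ℝ)) * expMul (n * a)) (expSeries (C c * expMul a)) := by
  refine (hasSum_expSeries _).congr_fun fun n => ?_
  rw [mul_pow, expMul_pow, ← map_pow, ← mul_assoc, ← map_mul]
  congr 2
  ring

/-- Convergence of formal series is coefficientwise, and the coefficient of `x^k` is the `k`-th
moment identity divided by `k!`. -/
theorem hasSum_weight_mul_expMul (m : ℕ) :
    HasSum (fun u : Fin m → ℕ => C (weight m u) * expMul (gammaCoeff m u))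
      (C (Real.exp (harmonicSum m)) * coverEGF m) := by
  rw [WithPiTopology.hasSum_iff_hasSum_coeff]
  intro k
  have h := hasSum_integral_jointLaw (integrable_gammaCoeff_pow m k)
  rw [integral_gammaCoeff_pow] at h
  simpa only [coeff_C_mul, coeff_expMul, coverEGF, coeff_mk] using h

theorem coverEGF_eq_tsum (m : ℕ) :
    coverEGF m = C (Real.exp (-harmonicSum m)) *
      ∑' u : Fin m → ℕ, C (weight m u) * expMul (gammaCoeff m u) := by
  rw [(hasSum_weight_mul_expMul m).tsum_eq, ← mul_assoc, ← map_mul, ← Real.exp_add]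
  simp

theorem coeff_one_add_X_pow_pow (j n d : ℕ) (hj : 0 < j) :
    ((1 + (Polynomial.X : Polynomial ℕ) ^ j) ^ n).coeff d =
      if j ∣ d then n.choose (d / j) else 0 := by
  have h : (1 + (Polynomial.X : Polynomial ℕ) ^ j) ^ n =
      Polynomial.expand ℕ j ((1 + Polynomial.X) ^ n) := by simp
  rw [h, Polynomial.coeff_expand hj, Polynomial.coeff_one_add_X_pow]
  simp

theorem gammaCoeff_two (u : Fin 2 → ℕ) : gammaCoeff 2 u = (u 0).choose 2 + u 1 := by
  rw [gammaCoeff, Fin.prod_univ_two, Polynomial.coeff_mul,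
    Finset.Nat.sum_antidiagonal_eq_sum_range_succ_mk]
  simp [Finset.sum_range_succ, coeff_one_add_X_pow_pow, Polynomial.coeff_one_add_X_pow]
  ring

theorem gammaCoeff_three (u : Fin 3 → ℕ) :
    gammaCoeff 3 u = (u 0).choose 3 + u 0 * u 1 + u 2 := by
  rw [gammaCoeff, Fin.prod_univ_three, Polynomial.coeff_mul,
    Finset.Nat.sum_antidiagonal_eq_sum_range_succ_mk]
  simp [Finset.sum_range_succ, coeff_one_add_X_pow_pow, Polynomial.coeff_mul,
    Finset.Nat.sum_antidiagonal_eq_sum_range_succ_mk,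
    Polynomial.coeff_one_add_X_pow]
  ring

end FormalSeries

/-! ### The closed forms for `m = 2` and `m = 3` -/

section SmallCases

open PowerSeries

/-- An exponential has nonzero constant term, hence is invertible; multiplying by the inverse also
transfers summability. -/
theorem summable_of_hasSum_mul_expSeries {ι : Type*} {f : ι → ℝ⟦X⟧} {a g : ℝ⟦X⟧}
    (h : HasSum (fun i => f i * expSeries g) a) :
    Summable f ∧ a = expSeries g * ∑' i, f i := by
  have hne : constantCoeff (expSeries g) ≠ 0 := by
    rw [constantCoeff_expSeries]
    exact (Real.exp_pos _).ne'
  have h2 := h.mul_right (expSeries g)⁻¹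
  simp_rw [mul_assoc, PowerSeries.mul_inv_cancel _ hne, mul_one] at h2
  refine ⟨h2.summable, ?_⟩
  rw [h2.tsum_eq, mul_left_comm, PowerSeries.mul_inv_cancel _ hne, mul_one]

theorem _root_.HasSum.prod_fiberwise_mul_left {ι κ R : Type*} [Ring R] [TopologicalSpace R]
    [IsTopologicalRing R] {f : ι → R} {g : ι → κ → R} {G : ι → R} {a : R}
    (h : HasSum (fun p : ι × κ => f p.1 * g p.1 p.2) a) (hg : ∀ i, HasSum (g i) (G i)) :
    HasSum (fun i => f i * G i) a :=
  h.prod_fiberwise fun i => (hg i).mul_left (f i)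

theorem harmonicSum_two : harmonicSum 2 = 3 / 2 := by
  rw [harmonicSum, Fin.sum_univ_two]
  norm_num

theorem harmonicSum_three : harmonicSum 3 = 11 / 6 := by
  rw [harmonicSum, Fin.sum_univ_three]
  norm_num

theorem C_exp_neg_mul_C_exp_mul (a : ℝ) (f : ℝ⟦X⟧) :
    C (Real.exp (-a)) * (C (Real.exp a) * f) = f := by
  rw [← mul_assoc, ← map_mul, ← Real.exp_add]
  simp

theorem weight_mul_expMul_two (r s : ℕ) :
    C (weight 2 ![r, s]) * expMul (gammaCoeff 2 ![r, s]) =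
      (C (1 / (r ! : ℝ)) * expMul (r.choose 2 : ℕ)) *
        (C ((1 / 2) ^ s / (s ! : ℝ)) * expMul (s * 1)) := by
  have h1 : weight 2 ![r, s] = 1 / (r ! : ℝ) * ((1 / 2) ^ s / (s ! : ℝ)) := by
    simp only [weight, Fin.prod_univ_two, one_div, inv_pow]
    norm_num
  have h2 : (gammaCoeff 2 ![r, s] : ℝ) = (r.choose 2 : ℕ) + s * 1 := by
    rw [gammaCoeff_two]
    simp
  rw [h1, h2, expMul_add, map_mul]
  ring

theorem weight_mul_expMul_three (r s t : ℕ) :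
    C (weight 3 ![r, s, t]) * expMul (gammaCoeff 3 ![r, s, t]) =
      (C (1 / (r ! : ℝ)) * expMul (r.choose 3 : ℕ) *
        (C ((1 / 2) ^ s / (s ! : ℝ)) * expMul (s * r))) *
        (C ((1 / 3) ^ t / (t ! : ℝ)) * expMul (t * 1)) := by
  have h1 : weight 3 ![r, s, t] =
      1 / (r ! : ℝ) * ((1 / 2) ^ s / (s ! : ℝ)) * ((1 / 3) ^ t / (t ! : ℝ)) := by
    simp only [weight, Fin.prod_univ_three, one_div, inv_pow, Matrix.cons_val]
    norm_num
  have h2 : (gammaCoeff 3 ![r, s, t] : ℝ) = (r.choose 3 : ℕ) + s * r + t * 1 := by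
    rw [gammaCoeff_three]
    simp [mul_comm]
  rw [h1, h2, expMul_add, expMul_add, map_mul, map_mul]
  ring

theorem coverEGF_two :
    Summable (fun r : ℕ => C (1 / (r ! : ℝ)) * expMul (r.choose 2 : ℕ)) ∧
      coverEGF 2 = C (Real.exp (-(3 / 2))) * expSeries (C (1 / 2) * expMul 1) *
        ∑' r : ℕ, C (1 / (r ! : ℝ)) * expMul (r.choose 2 : ℕ) := by
  have h1 := ((finTwoArrowEquiv ℕ).symm.hasSum_iff.2 (hasSum_weight_mul_expMul 2)).congr_fun
    (g := fun p : ℕ × ℕ => (C (1 / (p.1 ! : ℝ)) * expMul (p.1.choose 2 : ℕ)) *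
      (C ((1 / 2) ^ p.2 / (p.2 ! : ℝ)) * expMul (p.2 * 1)))
    (fun p => (weight_mul_expMul_two p.1 p.2).symm)
  have h2 : HasSum (fun r : ℕ => C (1 / (r ! : ℝ)) * expMul (r.choose 2 : ℕ) *
      expSeries (C (1 / 2) * expMul 1)) (C (Real.exp (harmonicSum 2)) * coverEGF 2) :=
    HasSum.prod_fiberwise_mul_left (f := fun r : ℕ => C (1 / (r ! : ℝ)) * expMul (r.choose 2 : ℕ))
      (g := fun _ s : ℕ => C ((1 / 2) ^ s / (s ! : ℝ)) * expMul (s * 1)) h1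
      fun _ => hasSum_expSeries_C_mul_expMul (1 / 2) 1
  obtain ⟨h3, h4⟩ := summable_of_hasSum_mul_expSeries h2
  refine ⟨h3, ?_⟩
  rw [mul_assoc, ← h4, ← harmonicSum_two, C_exp_neg_mul_C_exp_mul]

theorem coverEGF_three :
    Summable (fun r : ℕ => C (1 / (r ! : ℝ)) * expMul (r.choose 3 : ℕ) *
        expSeries (C (1 / 2) * expMul r)) ∧
      coverEGF 3 = C (Real.exp (-(11 / 6))) * expSeries (C (1 / 3) * expMul 1) *
        ∑' r : ℕ, C (1 / (r ! : ℝ)) * expMul (r.choose 3 : ℕ) *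
          expSeries (C (1 / 2) * expMul r) := by
  -- Grouped so that the last variable is summed first: its sum is a factor independent of `(r, s)`,
  -- which is divided out before summing over `s` at fixed `r`.
  let e : (ℕ × ℕ) × ℕ ≃ (Fin 3 → ℕ) :=
    { toFun := fun p => ![p.1.1, p.1.2, p.2]
      invFun := fun u => ((u 0, u 1), u 2)
      left_inv := fun _ => rfl
      right_inv := fun u => by ext i; fin_cases i <;> rfl }
  have h1 := (e.hasSum_iff.2 (hasSum_weight_mul_expMul 3)).congr_fun
    (g := fun p : (ℕ × ℕ) × ℕ => (C (1 / (p.1.1 ! : ℝ)) * expMul (p.1.1.choose 3 : ℕ) *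
        (C ((1 / 2) ^ p.1.2 / (p.1.2 ! : ℝ)) * expMul (p.1.2 * p.1.1))) *
      (C ((1 / 3) ^ p.2 / (p.2 ! : ℝ)) * expMul (p.2 * 1)))
    (fun p => (weight_mul_expMul_three p.1.1 p.1.2 p.2).symm)
  have h2 : HasSum (fun p : ℕ × ℕ => C (1 / (p.1 ! : ℝ)) * expMul (p.1.choose 3 : ℕ) *
        (C ((1 / 2) ^ p.2 / (p.2 ! : ℝ)) * expMul (p.2 * p.1)) *
        expSeries (C (1 / 3) * expMul 1)) (C (Real.exp (harmonicSum 3)) * coverEGF 3) :=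
    HasSum.prod_fiberwise_mul_left
      (f := fun p : ℕ × ℕ => C (1 / (p.1 ! : ℝ)) * expMul (p.1.choose 3 : ℕ) *
        (C ((1 / 2) ^ p.2 / (p.2 ! : ℝ)) * expMul (p.2 * p.1)))
      (g := fun _ t => C ((1 / 3) ^ t / (t ! : ℝ)) * expMul (t * 1)) h1
      fun _ => hasSum_expSeries_C_mul_expMul (1 / 3) 1
  obtain ⟨h3, h4⟩ := summable_of_hasSum_mul_expSeries h2
  have h5 : HasSum (fun r : ℕ => C (1 / (r ! : ℝ)) * expMul (r.choose 3 : ℕ) *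
        expSeries (C (1 / 2) * expMul r)) _ :=
    HasSum.prod_fiberwise_mul_left
      (f := fun r : ℕ => C (1 / (r ! : ℝ)) * expMul (r.choose 3 : ℕ))
      (g := fun r s : ℕ => C ((1 / 2) ^ s / (s ! : ℝ)) * expMul (s * r)) h3.hasSum
      fun r => hasSum_expSeries_C_mul_expMul (1 / 2) r
  refine ⟨h5.summable, ?_⟩
  rw [mul_assoc, h5.tsum_eq, ← h4, ← harmonicSum_three, C_exp_neg_mul_C_exp_mul]

end SmallCases

end MCover

/-! ### Transfer from the joint law to arbitrary independent Poisson variables -/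

theorem theorem2 {Ω : Type*} [MeasurableSpace Ω] (P : Measure Ω) [IsProbabilityMeasure P]
    (m : ℕ) (Z : Fin m → Ω → ℕ)
    (hlaw : ∀ i : Fin m, HasLaw (Z i) (poissonMeasure (1 / (((i : ℕ) : NNReal) + 1))) P)
    (hindep : iIndepFun Z P)
    (E : Ω → ℕ) (hE : ∀ ω, E ω = MCover.fixedSets m (fun i => Z i ω)) :
    -- the identities between formal power series in `x`
    (∀ k : ℕ, Integrable (fun ω => PowerSeries.coeff k (MCover.expMul (E ω))) P) ∧
    MCover.coverEGF m = MCover.expectation P (fun ω => MCover.expMul (E ω)) ∧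
    Summable (fun u : Fin m → ℕ =>
      PowerSeries.C (MCover.weight m u) * MCover.expMul (MCover.gammaCoeff m u)) ∧
    MCover.expectation P (fun ω => MCover.expMul (E ω)) =
      PowerSeries.C (Real.exp (-MCover.harmonicSum m)) *
        ∑' u : Fin m → ℕ,
          PowerSeries.C (MCover.weight m u) * MCover.expMul (MCover.gammaCoeff m u) ∧
    -- the identities at a real number `x`, with values in `[0, ∞]`
    (∀ x : ℝ, 0 ≤ x →
      ∑' k : ℕ, ENNReal.ofReal ((MCover.coverNumber k m : ℝ) / (k ! : ℝ) * x ^ k) =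
        ∫⁻ ω, ENNReal.ofReal (Real.exp (x * (E ω : ℝ))) ∂P) ∧
    (∀ x : ℝ,
      ∫⁻ ω, ENNReal.ofReal (Real.exp (x * (E ω : ℝ))) ∂P =
        ENNReal.ofReal (Real.exp (-MCover.harmonicSum m)) *
          ∑' u : Fin m → ℕ, ENNReal.ofReal
            (MCover.weight m u * Real.exp (x * (MCover.gammaCoeff m u : ℝ)))) ∧
    -- the identities at a real number `x` at which the series `V_m(x)` converges
    (∀ x : ℝ, Summable (fun k : ℕ => (MCover.coverNumber k m : ℝ) / (k ! : ℝ) * x ^ k) →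
      Integrable (fun ω => Real.exp (x * (E ω : ℝ))) P ∧
      ∑' k : ℕ, (MCover.coverNumber k m : ℝ) / (k ! : ℝ) * x ^ k =
        ∫ ω, Real.exp (x * (E ω : ℝ)) ∂P ∧
      Summable (fun u : Fin m → ℕ =>
        MCover.weight m u * Real.exp (x * (MCover.gammaCoeff m u : ℝ))) ∧
      ∫ ω, Real.exp (x * (E ω : ℝ)) ∂P =
        Real.exp (-MCover.harmonicSum m) * ∑' u : Fin m → ℕ,
          MCover.weight m u * Real.exp (x * (MCover.gammaCoeff m u : ℝ))) ∧
    -- the case `m = 2`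
    (Summable (fun r : ℕ =>
        PowerSeries.C (1 / (r ! : ℝ)) * MCover.expMul (r.choose 2 : ℕ)) ∧
      MCover.coverEGF 2 =
        PowerSeries.C (Real.exp (-(3 / 2))) *
          MCover.expSeries (PowerSeries.C (1 / 2) * MCover.expMul 1) *
          ∑' r : ℕ, PowerSeries.C (1 / (r ! : ℝ)) * MCover.expMul (r.choose 2 : ℕ)) ∧
    -- the case `m = 3`
    (Summable (fun r : ℕ =>
        PowerSeries.C (1 / (r ! : ℝ)) * MCover.expMul (r.choose 3 : ℕ) *
          MCover.expSeries (PowerSeries.C (1 / 2) * MCover.expMul r)) ∧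
      MCover.coverEGF 3 =
        PowerSeries.C (Real.exp (-(11 / 6))) *
          MCover.expSeries (PowerSeries.C (1 / 3) * MCover.expMul 1) *
          ∑' r : ℕ, PowerSeries.C (1 / (r ! : ℝ)) * MCover.expMul (r.choose 3 : ℕ) *
            MCover.expSeries (PowerSeries.C (1 / 2) * MCover.expMul r)) := by
  obtain rfl : E = fun ω => MCover.gammaCoeff m (fun i => Z i ω) :=
    funext fun ω => (hE ω).trans (MCover.fixedSets_eq_gammaCoeff m _)
  have hZ : HasLaw (fun ω i => Z i ω) (MCover.jointLaw m) P := hindep.hasLaw_pi hlaw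
  have hint : ∀ {g : (Fin m → ℕ) → ℝ}, Integrable g (MCover.jointLaw m) →
      Integrable (fun ω => g fun i => Z i ω) P := fun {g} hg => by
    rw [← hZ.map_eq] at hg
    exact hg.comp_aemeasurable hZ.aemeasurable
  have hintegral : ∀ g : (Fin m → ℕ) → ℝ,
      ∫ ω, g (fun i => Z i ω) ∂P = ∫ u, g u ∂MCover.jointLaw m := fun g =>
    hZ.integral_comp Measurable.of_discrete.aestronglyMeasurable
  have hlintegral : ∀ g : (Fin m → ℕ) → ENNReal,
      ∫⁻ ω, g (fun i => Z i ω) ∂P = ∫⁻ u, g u ∂MCover.jointLaw m := fun g =>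
    hZ.lintegral_comp Measurable.of_discrete.aemeasurable
  have hexp : MCover.coverEGF m = MCover.expectation P
      (fun ω => MCover.expMul (MCover.gammaCoeff m fun i => Z i ω)) := by
    ext k
    simp only [MCover.expectation, MCover.coverEGF, PowerSeries.coeff_mk, MCover.coeff_expMul]
    rw [hintegral fun u => (MCover.gammaCoeff m u : ℝ) ^ k / (k ! : ℝ),
      MCover.integral_gammaCoeff_pow]
  refine ⟨fun k => ?_, hexp, (MCover.hasSum_weight_mul_expMul m).summable,
    hexp.symm.trans (MCover.coverEGF_eq_tsum m), fun x hx => ?_, fun x => ?_, fun x hx => ?_,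
    MCover.coverEGF_two, MCover.coverEGF_three⟩
  · simp only [MCover.coeff_expMul]
    exact hint (MCover.integrable_gammaCoeff_pow m k)
  · rw [hlintegral fun u => ENNReal.ofReal (Real.exp (x * (MCover.gammaCoeff m u : ℝ))),
      MCover.lintegral_exp_gammaCoeff m x hx]
  · rw [hlintegral fun u => ENNReal.ofReal (Real.exp (x * (MCover.gammaCoeff m u : ℝ))),
      MCover.lintegral_jointLaw]
    simp_rw [ENNReal.ofReal_mul (MCover.weight_nonneg _)]
  · have hi := MCover.integrable_exp_gammaCoeff hx
    have hs := MCover.hasSum_integral_jointLaw hi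
    rw [hintegral fun u => Real.exp (x * (MCover.gammaCoeff m u : ℝ))]
    refine ⟨hint hi, MCover.integral_exp_gammaCoeff hx, hs.summable, ?_⟩
    rw [hs.tsum_eq, ← mul_assoc, ← Real.exp_add, neg_add_cancel, Real.exp_zero, one_mul]
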